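/- **Definitions.** A *good semigroup* of $\mathbb{N}^r$ ($r\ge 1$) is a submonoid $S\subseteq(\mathbb{N}^r,+)$ such that: (i) $\min(a,b)\in S$ (componentwise minimum) for all $a,b\in S$; (ii) if $a,b\in S$ and $a[i]=b[i]$, there is $c\in S$ with $c[i]>a[i]$, $c[j]\ge\min(a[j],b[j])$ for all $j\ne i$, and $c[j]=\min(a[j],b[j])$ whenever $a[j]\neq b[j]$; (iii) $\delta+\mathbb{N}^r\subseteq S$ for some $\delta\in S$. It is *local* if $\mathbf 0$ is its only element with a zero component, and *Arf* if $\{\beta-\alpha:\beta\in S,\ \beta\ge\alpha\}$ is closed under addition for every $\alpha\in S$. The *conductor* of $S$ is the least $\delta$ with $\delta+\mathbb{N}^r\subseteq S$. The *genus* of $S$ is the length of a saturated chain from $\mathbf 0$ to $\delta$ in $\mathbb{N}^r$ minus the length of a saturated chain from $\mathbf 0$ to $\delta$ in $S$. Let $T$ be a rooted tree with $r$ infinite branches whose nodes are vectors of $\mathbb{N}^r$; let $\mathbf n_i^j$ be the node of the $i$-th branch on level $j\ge1$. All branches share the root $\mathbf n_i^1$, and $\mathbf n_i^j[h]=0$ if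 and only if $\mathbf n_i^j$ does not lie on the $h$-th branch. Two branches are *glued* on level $j$ if they have the same node there. $T$ is the *multiplicity tree* of a local Arf good semigroup $S$ if $S$ consists of $\mathbf 0$ and of all sums $\sum_{\mathbf n\in T'}\mathbf n$ over the finite subtrees $T'$ of $T$ containing the root. $T$ is *untwisted* if two branches $i<h$ are glued on a level exactly when all pairs of consecutive branches between them are glued there. An untwisted multiplicity tree is written $T_E=(p_1,\dots,p_{r-1})$, $E=\{M_1,\dots,M_r\}$ (an ordered collection), where $M_i[j]=\mathbf n_i^j[i]$ and $p_i\ge 1$ is the highest level on which the branches $i$ and $i+1$ are glued; thus $\mathbf n_i^j[h]=M_h[j]$ if $j\le p_l$ for all $\min(i,h)\le l<\max(i,h)$, and $\mathbf n_i^j[h]=0$ otherwise. For a sequence $M$ occurring in such an $E$, let $s_{M,k}$ be the integer with $M[k]=\sum_{l=k+1}^{s_{M,k}}M[l]$. Put $\mathrm{Comp}(M,M)=+\infty$ and, for $M\ne M'$, $\mathrm{Comp}(M,M')=\min\{\min(s_{M,k},s_{M',k}):s_{M,k}\ne s_{M',k}\}$. Let $\mathrm{Gen}(r,n)$ be the set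 of the untwisted multiplicity trees of the local Arf good semigroups of $\mathbb{N}^r$ with genus $n$. **Statement.** Let $r\ge2$ and $1\le t<r$. If $n\ge r-1$, then $$\mathrm{Gen}(r,n)=\bigcup_{p=1}^{n-r+2}\ \bigcup_{k=t-1}^{n-p-r+t+1} I_r^n(t,p,k),$$ where $I_r^n(t,p,k)$ is the set of all $T_E=(p_1,\dots,p_{r-1})$, $E=\{M_1,\dots,M_r\}$, such that - $T_{E_t}=(p_1,\dots,p_{t-1})\in\mathrm{Gen}(t,k)$, where $E_t=\{M_1,\dots,M_t\}$; - $T_{E^t}=(p_{t+1},\dots,p_{r-1})\in\mathrm{Gen}(r-t,\,n-p-k)$, where $E^t=\{M_{t+1},\dots,M_r\}$; - $p_t=p\le\mathrm{Comp}(M_t,M_{t+1})$. If $0\le n<r-1$, then $\mathrm{Gen}(r,n)=\emptyset$. -/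

import Mathlib

namespace ArfGenus

/-! ### Good semigroups of `ℕ^r`, conductor and genus -/

/-- A good semigroup of `ℕ^r`. -/
structure IsGoodSemigroup {r : ℕ} (S : AddSubmonoid (Fin r → ℕ)) : Prop where
  min_mem : ∀ a ∈ S, ∀ b ∈ S, a ⊓ b ∈ S
  exchange : ∀ a ∈ S, ∀ b ∈ S, ∀ i, a i = b i →
    ∃ c ∈ S, a i < c i ∧ (∀ j, j ≠ i → min (a j) (b j) ≤ c j) ∧
      ∀ j, a j ≠ b j → c j = min (a j) (b j)
  exists_conductor : ∃ δ ∈ S, ∀ v, δ + v ∈ S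

/-- `S` is local: the zero vector is the only element with some zero component. -/
def IsLocal {r : ℕ} (S : AddSubmonoid (Fin r → ℕ)) : Prop :=
  ∀ a ∈ S, (∃ i, a i = 0) → a = 0

/-- The Arf property: for each `α ∈ S` the set `S(α) - α = {x : α + x ∈ S}` is closed under
addition. -/
def IsArf {r : ℕ} (S : AddSubmonoid (Fin r → ℕ)) : Prop :=
  ∀ α ∈ S, ∀ x y, α + x ∈ S → α + y ∈ S → α + (x + y) ∈ S

/-- `S` is a local Arf good semigroup of `ℕ^r`. -/
structure IsLocalArfGood {r : ℕ} (S : AddSubmonoid (Fin r → ℕ)) : Prop where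
  good : IsGoodSemigroup S
  isLocal : IsLocal S
  arf : IsArf S

/-- `δ` is the conductor of `S`: the least vector with `δ + ℕ^r ⊆ S`. -/
def IsConductor {r : ℕ} (S : AddSubmonoid (Fin r → ℕ)) (δ : Fin r → ℕ) : Prop :=
  IsLeast {c : Fin r → ℕ | ∀ v, c + v ∈ S} δ

/-- There is a saturated chain `α = c 0 < c 1 < ⋯ < c m = β` in `S` (no element of `S` can be
inserted). -/
def HasSaturatedChain {r : ℕ} (S : AddSubmonoid (Fin r → ℕ)) (α β : Fin r → ℕ) (m : ℕ) : Prop :=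
  ∃ c : ℕ → Fin r → ℕ, c 0 = α ∧ c m = β ∧ (∀ q ≤ m, c q ∈ S) ∧
    ∀ q < m, c q < c (q + 1) ∧ ∀ s ∈ S, ¬ (c q < s ∧ s < c (q + 1))

/-- The genus of `S` is `n`: with `δ` the conductor and `C = δ + ℕ^r`,
`n = d(ℕ^r ∖ C) - d(S ∖ C)`, where `d(ℕ^r ∖ C)` and `d(S ∖ C)` are the lengths of saturated chains
from `0` to `δ` in `ℕ^r` and in `S`. -/
def HasGenus {r : ℕ} (S : AddSubmonoid (Fin r → ℕ)) (n : ℕ) : Prop :=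
  ∃ (δ : Fin r → ℕ) (m₁ m₂ : ℕ), IsConductor S δ ∧ HasSaturatedChain ⊤ 0 δ m₁ ∧
    HasSaturatedChain S 0 δ m₂ ∧ (n : ℤ) = (m₁ : ℤ) - (m₂ : ℤ)

/-! ### Trees of vectors with `r` branches -/

/-- A family of nodes for a tree with `r` infinite branches: `T i j` is the node of the `i`-th
branch on level `j + 1` (levels are counted from `1`, indices `j` from `0`). Two branches are
glued on a level when they have the same node there. -/
abbrev VecTree (r : ℕ) : Type := Fin r → ℕ → (Fin r → ℕ)

/-- The nodes form a tree with a single root whose vectors record the branches through a node. -/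
structure IsVecTree {r : ℕ} (T : VecTree r) : Prop where
  root : ∀ i h, T i 0 = T h 0
  parent : ∀ i h j, T i (j + 1) = T h (j + 1) → T i j = T h j
  support : ∀ i j h, T i j h = 0 ↔ T i j ≠ T h j

/-- `N` is (the node set of) a finite subtree of `T` rooted in the root of `T`. A node is recorded
together with its level index, since the same vector may occur on several levels. -/
def IsRootedSubtree {r : ℕ} (T : VecTree r) (N : Finset (ℕ × (Fin r → ℕ))) : Prop :=
  (∃ i, (0, T i 0) ∈ N) ∧ (∀ x ∈ N, ∃ i, x.2 = T i x.1) ∧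
    ∀ i j, (j + 1, T i (j + 1)) ∈ N → (j, T i j) ∈ N

/-- `{0}` together with all sums of the nodes of finite rooted subtrees of `T`. -/
def subtreeSums {r : ℕ} (T : VecTree r) : Set (Fin r → ℕ) :=
  {0} ∪ {v | ∃ N, IsRootedSubtree T N ∧ v = ∑ x ∈ N, x.2}

/-- `T` is the multiplicity tree of `S`. -/
def IsMultiplicityTreeOf {r : ℕ} (T : VecTree r) (S : AddSubmonoid (Fin r → ℕ)) : Prop :=
  IsVecTree T ∧ (S : Set (Fin r → ℕ)) = subtreeSums T

/-- `T` is untwisted: two branches are glued on a level if and only if all consecutive branches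
between them are glued there. -/
def IsUntwisted {r : ℕ} (T : VecTree r) : Prop :=
  ∀ i h : Fin r, i < h → ∀ j, T i j = T h j ↔
    ∀ (k : ℕ) (hk : k + 1 < r), (i : ℕ) ≤ k → k < (h : ℕ) →
      T ⟨k, by omega⟩ j = T ⟨k + 1, hk⟩ j

/-- `Gen(r,n)`: the untwisted multiplicity trees of the local Arf good semigroups of `ℕ^r` with
genus `n`. -/
def Gen (r n : ℕ) : Set (VecTree r) :=
  {T | IsUntwisted T ∧ ∃ S : AddSubmonoid (Fin r → ℕ),
    IsLocalArfGood S ∧ IsMultiplicityTreeOf T S ∧ HasGenus S n}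

/-! ### The description of untwisted trees by sequences and gluing levels -/

/-- The untwisted tree `T_E = (p_1, …, p_{r-1})`, `E = {M_1, …, M_r}`. Here `E h j = M_{h+1}[j+1]`
and `p k = p_{k+1}` is the highest level on which the branches with indices `k`, `k + 1` are
glued. The node of branch `i` on level `j + 1` has `h`-th coordinate `E h j` if the branches `i`
and `h` are glued on that level, that is, `j + 1` is at most the minimum of the levels `p k`
between them, and `0` otherwise. -/
def treeOf {r : ℕ} (E : Fin r → ℕ → ℕ) (p : Fin (r - 1) → ℕ) : VecTree r :=
  open Classical in fun i j h =>
    if ∀ k : Fin (r - 1), min (i : ℕ) h ≤ k → (k : ℕ) < max (i : ℕ) h → j + 1 ≤ p k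
    then E h j else 0

/-- For a multiplicity sequence `M` (with `M j = M[j+1]`), the integer `s` such that
`M[j+1] = M[j+2] + ⋯ + M[s]`. -/
noncomputable def sumEnd (M : ℕ → ℕ) (j : ℕ) : ℕ :=
  sInf {s | M j = ∑ l ∈ Finset.Ico (j + 1) s, M l}

/-- The compatibility `Comp(M, M')` of two multiplicity sequences. -/
noncomputable def Comp (M M' : ℕ → ℕ) : ℕ∞ :=
  open Classical in
  if M = M' then ⊤
  else sInf {c : ℕ∞ | ∃ j, sumEnd M j ≠ sumEnd M' j ∧ c = (min (sumEnd M j) (sumEnd M' j) : ℕ)}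

/-- The set `I_r^n(t,p,k)` of the trees `T_E = (p_1, …, p_{r-1})` with
`T_{E_t} = (p_1, …, p_{t-1}) ∈ Gen(t,k)`, `T_{E^t} = (p_{t+1}, …, p_{r-1}) ∈ Gen(r-t,n-p-k)` and
`p_t = p ≤ Comp(M_t, M_{t+1})`, where `E_t = {M_1, …, M_t}` and `E^t = {M_{t+1}, …, M_r}`. -/
def glueSet (r n t : ℕ) (ht : 1 ≤ t) (htr : t < r) (p k : ℕ) : Set (VecTree r) :=
  {T | ∃ (E : Fin r → ℕ → ℕ) (q : Fin (r - 1) → ℕ), T = treeOf E q ∧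
    treeOf (fun i : Fin t => E ⟨i, by omega⟩)
      (fun l : Fin (t - 1) => q ⟨l, by omega⟩) ∈ Gen t k ∧
    treeOf (fun i : Fin (r - t) => E ⟨t + i, by omega⟩)
      (fun l : Fin (r - t - 1) => q ⟨t + l, by omega⟩) ∈ Gen (r - t) (n - p - k) ∧
    q ⟨t - 1, by omega⟩ = p ∧
    (p : ℕ∞) ≤ Comp (E ⟨t - 1, by omega⟩) (E ⟨t, htr⟩)}

end ArfGenus

/-!
A finite rooted subtree of `T` is determined by the number of its nodes on each branch, so the
elements of `S` are indexed by the level vectors of subtrees, and each step of a saturated chain in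
`S` adds exactly one node. Hence the genus is the sum of `|𝐧| - 1` over all nodes `𝐧` of `T`, where
`|𝐧|` is the sum of the coordinates. Level `j` of `T_E = (p_1, …, p_{r-1})` carries
`r - #{k | j ≤ p_k}` nodes, so the genus of `T_E` is `∑_{i,j} (M_i[j] - 1) + ∑_k p_k`.

`T` comes from a local Arf good semigroup if and only if it ends in unit vectors and each node is
the sum of a finite subtree hanging below it. For `T_E` this says that every `M_i` is a multiplicity
sequence and that `(s_{M_i,j})_i` is the level vector of a subtree for every `j`, which is the
condition `p_k ≤ Comp(M_k, M_{k+1})` for all `k`. Both the conditions and the genus formula involve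
only single branches and consecutive pairs, so they split at the pair `(t, t + 1)`, whose share of
the genus is `p_t`.
-/

namespace ArfGenus

/-! ### Multiplicity sequences -/

/-- The sum of the first `l` terms of a multiplicity sequence. -/
def partialSum (M : ℕ → ℕ) (l : ℕ) : ℕ := ∑ j ∈ Finset.range l, M j

/-- A multiplicity sequence: positive, eventually one, each term a sum of consecutive subsequent
terms (so that the set in the definition of `sumEnd` is nonempty). -/
structure IsMultSeq (M : ℕ → ℕ) : Prop where
  pos : ∀ j, 0 < M j
  eventually_one : ∃ N, ∀ j, N ≤ j → M j = 1
  exists_sum : ∀ j, ∃ s, M j = ∑ l ∈ Finset.Ico (j + 1) s, M l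

/-- The contribution of a multiplicity sequence to the genus, which is the genus of the numerical
Arf semigroup of the sequence. -/
noncomputable def seqGenus (M : ℕ → ℕ) : ℕ := ∑ᶠ j, (M j - 1)

section

variable {M M' : ℕ → ℕ}

lemma partialSum_succ (M : ℕ → ℕ) (l : ℕ) : partialSum M (l + 1) = partialSum M l + M l :=
  Finset.sum_range_succ _ _

lemma partialSum_mono (M : ℕ → ℕ) : Monotone (partialSum M) :=
  monotone_nat_of_le_succ fun l => by simp only [partialSum_succ, Nat.le_add_right]

lemma partialSum_strictMono (hM : ∀ j, 0 < M j) : StrictMono (partialSum M) :=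
  strictMono_nat_of_lt_succ fun l => by simp only [partialSum_succ, lt_add_iff_pos_right, hM l]

lemma partialSum_add_of_forall_eq_one {l : ℕ} (hl : ∀ j, l ≤ j → M j = 1) (d : ℕ) :
    partialSum M (l + d) = partialSum M l + d := by
  induction d with
  | zero => rfl
  | succ d ih => rw [← add_assoc, partialSum_succ, ih, hl _ (Nat.le_add_right l d), add_assoc]

lemma partialSum_eq_add_seqGenus (hM : ∀ j, 0 < M j) {N : ℕ} (hN : ∀ j, N ≤ j → M j = 1) :
    partialSum M N = N + seqGenus M := by
  have hsupp : (Function.support fun j => M j - 1) ⊆ Finset.range N := by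
    intro j hj
    by_contra hNj
    exact hj (by simp [hN j (by simpa using hNj)])
  calc partialSum M N = ∑ j ∈ Finset.range N, (1 + (M j - 1)) :=
        Finset.sum_congr rfl fun j _ => (Nat.add_sub_cancel' (hM j)).symm
    _ = N + seqGenus M := by
        rw [Finset.sum_add_distrib, seqGenus, finsum_eq_sum_of_support_subset _ hsupp]
        simp

lemma eq_sum_Ico_iff {j s : ℕ} (hj : 0 < M j) :
    M j = ∑ l ∈ Finset.Ico (j + 1) s, M l ↔ partialSum M s = partialSum M (j + 1) + M j := by
  rcases le_total (j + 1) s with hs | hs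
  · rw [partialSum, partialSum, ← Finset.sum_range_add_sum_Ico M hs, add_right_inj, eq_comm]
  · have := partialSum_mono M hs
    rw [Finset.Ico_eq_empty_of_le hs, Finset.sum_empty]
    omega

lemma sumEnd_eq (hM : ∀ j, 0 < M j) {j s : ℕ} (hs : M j = ∑ l ∈ Finset.Ico (j + 1) s, M l) :
    sumEnd M j = s := by
  have hmem : M j = ∑ l ∈ Finset.Ico (j + 1) (sumEnd M j), M l :=
    Nat.sInf_mem (s := {s | M j = ∑ l ∈ Finset.Ico (j + 1) s, M l}) ⟨s, hs⟩
  rw [eq_sum_Ico_iff (hM j)] at hs hmem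
  exact (partialSum_strictMono hM).injective (hmem.trans hs.symm)

lemma IsMultSeq.eq_sum_sumEnd (hM : IsMultSeq M) (j : ℕ) :
    M j = ∑ l ∈ Finset.Ico (j + 1) (sumEnd M j), M l :=
  Nat.sInf_mem (hM.exists_sum j)

lemma le_comp_iff {p : ℕ} :
    (p : ℕ∞) ≤ Comp M M' ↔ ∀ j, min (sumEnd M j) p = min (sumEnd M' j) p := by
  unfold Comp
  split_ifs with h
  · simp [h]
  · rw [le_sInf_iff]
    constructor
    · intro hp j
      by_cases hs : sumEnd M j = sumEnd M' j
      · rw [hs]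
      · have : p ≤ min (sumEnd M j) (sumEnd M' j) := mod_cast hp _ ⟨j, hs, rfl⟩
        omega
    · rintro hp _ ⟨j, hs, rfl⟩
      have := hp j
      exact_mod_cast (by omega : p ≤ min (sumEnd M j) (sumEnd M' j))

end

/-! ### Saturated chains and conductors -/

/-- A rank function on `S`: strictly increasing, and below any larger element `b` of `S` one can
climb from `a` by a step of rank one. It computes the lengths of saturated chains. -/
structure IsRankFunction {r : ℕ} (S : AddSubmonoid (Fin r → ℕ)) (ρ : (Fin r → ℕ) → ℕ) :
    Prop where
  strictMonoOn : StrictMonoOn ρ S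
  exists_step : ∀ a ∈ S, ∀ b ∈ S, a < b → ∃ c ∈ S, a < c ∧ c ≤ b ∧ ρ c = ρ a + 1

section

variable {r : ℕ} {S : AddSubmonoid (Fin r → ℕ)} {ρ : (Fin r → ℕ) → ℕ} {α β γ : Fin r → ℕ} {m : ℕ}

lemma HasSaturatedChain.cons (hα : α ∈ S) (hαγ : α < γ) (hsat : ∀ s ∈ S, ¬(α < s ∧ s < γ))
    (h : HasSaturatedChain S γ β m) : HasSaturatedChain S α β (m + 1) := by
  obtain ⟨c, rfl, hm, hmem, hstep⟩ := h
  refine ⟨fun q => q.casesOn α c, rfl, hm, ?_, ?_⟩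
  · rintro (_ | q) hq
    exacts [hα, hmem q (Nat.le_of_succ_le_succ hq)]
  · rintro (_ | q) hq
    exacts [⟨hαγ, hsat⟩, hstep q (Nat.lt_of_succ_lt_succ hq)]

lemma HasSaturatedChain.rank_eq (hρ : IsRankFunction S ρ) (h : HasSaturatedChain S α β m) :
    ρ β = ρ α + m := by
  obtain ⟨c, rfl, rfl, hmem, hsat⟩ := h
  have rank_chain : ∀ q ≤ m, ρ (c q) = ρ (c 0) + q := by
    intro q hq
    induction q with
    | zero => rfl
    | succ q ih =>
      obtain ⟨hlt, hno⟩ := hsat q hq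
      obtain ⟨x, hx, hcx, hxc, hρx⟩ :=
        hρ.exists_step _ (hmem q (Nat.le_of_succ_le hq)) _ (hmem _ hq) hlt
      obtain rfl : x = c (q + 1) := hxc.eq_of_not_lt fun hxlt => hno x hx ⟨hcx, hxlt⟩
      rw [hρx, ih (Nat.le_of_succ_le hq), add_assoc]
  exact rank_chain m le_rfl

lemma IsRankFunction.hasSaturatedChain (hρ : IsRankFunction S ρ) (hα : α ∈ S) (hβ : β ∈ S)
    (hαβ : α ≤ β) (hm : ρ β = ρ α + m) : HasSaturatedChain S α β m := by
  induction m generalizing α with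
  | zero =>
    obtain rfl : α = β := hαβ.eq_of_not_lt fun hlt => (hρ.strictMonoOn hα hβ hlt).ne' hm
    exact ⟨fun _ => α, rfl, rfl, fun _ _ => hα, fun q hq => absurd hq q.not_lt_zero⟩
  | succ m ih =>
    have hlt : α < β := hαβ.lt_of_ne (by rintro rfl; omega)
    obtain ⟨γ, hγ, hαγ, hγβ, hργ⟩ := hρ.exists_step α hα β hβ hlt
    refine .cons hα hαγ (fun s hs ⟨hαs, hsγ⟩ => ?_) (ih hγ hγβ (by omega))
    have := hρ.strictMonoOn hα hs hαs
    have := hρ.strictMonoOn hs hγ hsγ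
    omega

lemma IsRankFunction.hasSaturatedChain_iff (hρ : IsRankFunction S ρ) (hα : α ∈ S) (hβ : β ∈ S)
    (hαβ : α ≤ β) : HasSaturatedChain S α β m ↔ ρ β = ρ α + m :=
  ⟨fun h => h.rank_eq hρ, hρ.hasSaturatedChain hα hβ hαβ⟩

lemma isRankFunction_top_sum : IsRankFunction (⊤ : AddSubmonoid (Fin r → ℕ)) (∑ i, · i) where
  strictMonoOn a _ b _ hab := by
    obtain ⟨hle, i, hi⟩ := Pi.lt_def.1 hab
    exact Finset.sum_lt_sum (fun i _ => hle i) ⟨i, Finset.mem_univ _, hi⟩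
  exists_step a _ b _ hab := by
    obtain ⟨hle, i, hi⟩ := Pi.lt_def.1 hab
    refine ⟨a + Pi.single i 1, trivial, ?_, fun j => ?_, ?_⟩
    · exact Pi.lt_def.2 ⟨le_self_add, i, by simp⟩
    · rcases eq_or_ne j i with rfl | hji
      · simpa using hi
      · simpa [hji] using hle j
    · simp [Finset.sum_add_distrib]

lemma IsGoodSemigroup.exists_isConductor (hS : IsGoodSemigroup S) : ∃ δ, IsConductor S δ := by
  obtain ⟨δ₀, -, hδ₀⟩ := hS.exists_conductor
  obtain ⟨δ, hδ, hmin⟩ := wellFounded_lt.has_min {c : Fin r → ℕ | ∀ v, c + v ∈ S} ⟨δ₀, hδ₀⟩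
  refine ⟨δ, hδ, fun c hc => ?_⟩
  have hinf : ∀ v, δ ⊓ c + v ∈ S := fun v => by
    have key : δ ⊓ c + v = (δ + (δ ⊓ c + v - δ)) ⊓ (c + (δ ⊓ c + v - c)) := by
      ext i
      simp only [Pi.add_apply, Pi.inf_apply, Pi.sub_apply]
      omega
    exact key ▸ hS.min_mem _ (hδ _) _ (hc _)
  exact inf_eq_left.1 (inf_le_left.eq_of_not_lt (hmin _ hinf))

end

/-! ### Level vectors of subtrees -/

/-- The multiplicity sequence of the `i`-th branch. -/
def branchSeq {r : ℕ} (T : VecTree r) (i : Fin r) (j : ℕ) : ℕ := T i j i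

/-- The level vectors of the finite rooted subtrees of `T`: cutting the `i`-th branch after its
first `L i` nodes is consistent on glued branches. -/
def Admissible {r : ℕ} (T : VecTree r) (L : Fin r → ℕ) : Prop :=
  ∀ i h j, T i j = T h j → j < L i → j < L h

/-- The subtree with level vector `L`, in the encoding of `IsRootedSubtree`. -/
def nodes {r : ℕ} (T : VecTree r) (L : Fin r → ℕ) : Finset (ℕ × (Fin r → ℕ)) :=
  Finset.univ.biUnion fun i => (Finset.range (L i)).image fun j => (j, T i j)

/-- The sum of the nodes of the subtree with level vector `L`, computed branch by branch. -/
def treeSum {r : ℕ} (T : VecTree r) (L : Fin r → ℕ) (i : Fin r) : ℕ :=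
  partialSum (branchSeq T i) (L i)

section

variable {r : ℕ} {T : VecTree r} {K L : Fin r → ℕ} {i h : Fin r} {j l : ℕ}

lemma Admissible.lt_iff (hL : Admissible T L) (hj : T i j = T h j) : j < L i ↔ j < L h :=
  ⟨hL i h j hj, hL h i j hj.symm⟩

lemma Admissible.inf (hK : Admissible T K) (hL : Admissible T L) : Admissible T (K ⊓ L) :=
  fun i h j hj hlt =>
    lt_min (hK i h j hj (hlt.trans_le (min_le_left _ _)))
      (hL i h j hj (hlt.trans_le (min_le_right _ _)))

lemma admissible_const (N : ℕ) : Admissible T fun _ => N := fun _ _ _ _ => id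

lemma mem_nodes {v : Fin r → ℕ} : (j, v) ∈ nodes T L ↔ ∃ i, j < L i ∧ T i j = v := by
  simp only [nodes, Finset.mem_biUnion, Finset.mem_univ, true_and, Finset.mem_image,
    Finset.mem_range, Prod.mk.injEq, existsAndEq]

lemma Admissible.mem_nodes_iff (hL : Admissible T L) : (j, T i j) ∈ nodes T L ↔ j < L i :=
  mem_nodes.trans ⟨fun ⟨h, hlt, hj⟩ => hL h i j hj hlt, fun hlt => ⟨i, hlt, rfl⟩⟩

lemma nodes_zero : nodes T 0 = ∅ :=
  Finset.eq_empty_of_forall_notMem fun ⟨_, _⟩ hx =>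
    have ⟨_, hlt, _⟩ := mem_nodes.1 hx
    Nat.not_lt_zero _ hlt

lemma nodes_mono : Monotone (nodes T) := fun _ _ hKL ⟨_, _⟩ hx =>
  let ⟨h, hlt, hj⟩ := mem_nodes.1 hx
  mem_nodes.2 ⟨h, hlt.trans_le (hKL h), hj⟩

lemma Admissible.nodes_ssubset (hK : Admissible T K) (hL : Admissible T L) (hKL : K < L) :
    nodes T K ⊂ nodes T L := by
  obtain ⟨hle, i, hi⟩ := Pi.lt_def.1 hKL
  exact (Finset.ssubset_iff_of_subset (nodes_mono hle)).2
    ⟨(K i, T i (K i)), hL.mem_nodes_iff.2 hi, fun hx => (hK.mem_nodes_iff.1 hx).false⟩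

lemma IsVecTree.antitone_glued (hT : IsVecTree T) (i h : Fin r) :
    Antitone fun j => T i j = T h j :=
  antitone_nat_of_succ_le fun j => hT.parent i h j

lemma IsVecTree.branchSeq_pos (hT : IsVecTree T) (i : Fin r) (j : ℕ) : 0 < branchSeq T i j :=
  Nat.pos_of_ne_zero fun h => (hT.support i j i).1 h rfl

lemma IsVecTree.partialSum_strictMono (hT : IsVecTree T) (i : Fin r) :
    StrictMono (partialSum (branchSeq T i)) :=
  ArfGenus.partialSum_strictMono (hT.branchSeq_pos i)

lemma IsVecTree.treeSum_le_iff (hT : IsVecTree T) : treeSum T K ≤ treeSum T L ↔ K ≤ L :=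
  forall_congr' fun i => (hT.partialSum_strictMono i).le_iff_le

lemma IsVecTree.treeSum_lt_iff (hT : IsVecTree T) : treeSum T K < treeSum T L ↔ K < L :=
  lt_iff_lt_of_le_iff_le' hT.treeSum_le_iff hT.treeSum_le_iff

lemma IsVecTree.treeSum_injective (hT : IsVecTree T) : Function.Injective (treeSum T) :=
  fun _ _ h => le_antisymm (hT.treeSum_le_iff.1 h.le) (hT.treeSum_le_iff.1 h.ge)

lemma IsVecTree.treeSum_inf (hT : IsVecTree T) (K L : Fin r → ℕ) :
    treeSum T (K ⊓ L) = treeSum T K ⊓ treeSum T L :=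
  funext fun i => (hT.partialSum_strictMono i).monotone.map_min

lemma IsVecTree.sum_nodes (hT : IsVecTree T) (hL : Admissible T L) :
    ∑ x ∈ nodes T L, x.2 = treeSum T L := by
  ext i
  let branch : Finset (ℕ × (Fin r → ℕ)) := (Finset.range (L i)).image fun j => (j, T i j)
  have hsub : branch ⊆ nodes T L := Finset.subset_biUnion_of_mem
    (fun i => (Finset.range (L i)).image fun j => (j, T i j)) (Finset.mem_univ i)
  have hzero : ∀ x ∈ nodes T L, x ∉ branch → x.2 i = 0 := by
    rintro ⟨j, v⟩ hx hxb
    obtain ⟨h, hlt, rfl⟩ := mem_nodes.1 hx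
    refine (hT.support h j i).2 fun hj => hxb ?_
    exact Finset.mem_image.2 ⟨j, Finset.mem_range.2 (hL h i j hj hlt), by rw [hj]⟩
  rw [Finset.sum_apply, ← Finset.sum_subset hsub hzero,
    Finset.sum_image fun a _ b _ hab => (Prod.mk.inj hab).1]
  rfl

lemma IsRootedSubtree.exists_eq_nodes {N : Finset (ℕ × (Fin r → ℕ))} (hN : IsRootedSubtree T N) :
    ∃ L, Admissible T L ∧ N = nodes T L := by
  have exists_height : ∀ i, ∃ l, ∀ j, (j, T i j) ∈ N ↔ j < l := by
    intro i
    have hlower : IsLowerSet {j | (j, T i j) ∈ N} :=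
      fun a b hba ha =>
        antitone_nat_of_succ_le (f := fun j => (j, T i j) ∈ N) (hN.2.2 i) hba ha
    have hfinite : {j | (j, T i j) ∈ N}.Finite :=
      N.finite_toSet.preimage fun a _ b _ hab => (Prod.mk.inj hab).1
    obtain ⟨l, hl⟩ := hlower.eq_univ_or_Iio.resolve_left
      fun huniv => Set.infinite_univ (huniv ▸ hfinite)
    exact ⟨l, Set.ext_iff.1 hl⟩
  choose L hL using exists_height
  refine ⟨L, fun i h j hj => by rw [← hL, ← hL, hj]; exact id, ?_⟩
  ext ⟨j, v⟩
  rw [mem_nodes]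
  constructor
  · intro hx
    obtain ⟨i, rfl⟩ : ∃ i, v = T i j := hN.2.1 _ hx
    exact ⟨i, (hL i j).1 hx, rfl⟩
  · rintro ⟨i, hlt, rfl⟩
    exact (hL i j).2 hlt

lemma Admissible.isRootedSubtree_nodes (hL : Admissible T L) (hL0 : L ≠ 0) :
    IsRootedSubtree T (nodes T L) := by
  obtain ⟨i, hi⟩ := Function.ne_iff.1 hL0
  refine ⟨⟨i, hL.mem_nodes_iff.2 (Nat.pos_of_ne_zero hi)⟩, fun ⟨j, v⟩ hx => ?_, fun h j hj => ?_⟩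
  · obtain ⟨h, -, hx⟩ := mem_nodes.1 hx
    exact ⟨h, hx.symm⟩
  · exact hL.mem_nodes_iff.2 (Nat.lt_of_succ_lt (hL.mem_nodes_iff.1 hj))

lemma IsVecTree.mem_subtreeSums_iff (hT : IsVecTree T) {v : Fin r → ℕ} :
    v ∈ subtreeSums T ↔ ∃ L, Admissible T L ∧ treeSum T L = v := by
  constructor
  · rintro (rfl | ⟨N, hN, rfl⟩)
    · exact ⟨0, admissible_const 0, rfl⟩
    · obtain ⟨L, hL, rfl⟩ := hN.exists_eq_nodes
      exact ⟨L, hL, (hT.sum_nodes hL).symm⟩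
  · rintro ⟨L, hL, rfl⟩
    rcases eq_or_ne L 0 with rfl | hL0
    · exact Or.inl rfl
    · exact Or.inr ⟨nodes T L, hL.isRootedSubtree_nodes hL0, (hT.sum_nodes hL).symm⟩

end

/-! ### Grafting -/

/-- The level vector that agrees with `K` on the branches through the first node of the `i`-th
branch outside the subtree with level vector `L`, and with `L` on all other branches. -/
def graft {r : ℕ} (T : VecTree r) (L : Fin r → ℕ) (i : Fin r) (K : Fin r → ℕ) : Fin r → ℕ :=
  open Classical in fun h => if T i (L i) = T h (L i) then K h else L h

/-- The level vector of the subtree with level vector `L`, extended by the next node of the `i`-th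
branch. -/
def addNode {r : ℕ} (T : VecTree r) (L : Fin r → ℕ) (i : Fin r) : Fin r → ℕ :=
  graft T L i fun _ => L i + 1

section

variable {r : ℕ} {T : VecTree r} {K L : Fin r → ℕ} {i h : Fin r}

lemma Admissible.eq_of_glued (hT : IsVecTree T) (hL : Admissible T L)
    (hi : T i (L i) = T h (L i)) : L h = L i := by
  refine le_antisymm (not_lt.1 fun hlt => ?_) (not_lt.1 fun hlt => ?_)
  · exact ((hL.lt_iff hi).2 hlt).false
  · exact ((hL.lt_iff (hT.antitone_glued i h hlt.le hi)).1 hlt).false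

lemma graft_of_glued (hi : T i (L i) = T h (L i)) : graft T L i K h = K h := if_pos hi

lemma graft_of_not_glued (hi : T i (L i) ≠ T h (L i)) : graft T L i K h = L h := if_neg hi

lemma admissible_graft (hT : IsVecTree T) (hL : Admissible T L) (hK : Admissible T K)
    (hLK : ∀ h, T i (L i) = T h (L i) → L i ≤ K h) : Admissible T (graft T L i K) := by
  intro a b j hab hlt
  have lt_of_separated : ¬(T a (L i) = T b (L i)) → j < L i :=
    fun hne => not_le.1 fun hle => hne (hT.antitone_glued a b hle hab)
  by_cases ha : T i (L i) = T a (L i) <;> by_cases hb : T i (L i) = T b (L i)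
  · rw [graft_of_glued ha] at hlt
    rw [graft_of_glued hb]
    exact hK a b j hab hlt
  · rw [graft_of_not_glued hb]
    refine hL a b j hab ?_
    rw [hL.eq_of_glued hT ha]
    exact lt_of_separated fun h => hb (ha.trans h)
  · rw [graft_of_glued hb]
    exact (lt_of_separated fun h => ha (hb.trans h.symm)).trans_le (hLK b hb)
  · rw [graft_of_not_glued ha] at hlt
    rw [graft_of_not_glued hb]
    exact hL a b j hab hlt

lemma addNode_apply_self : addNode T L i i = L i + 1 := if_pos rfl

lemma admissible_addNode (hT : IsVecTree T) (hL : Admissible T L) :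
    Admissible T (addNode T L i) :=
  admissible_graft hT hL (admissible_const _) fun _ _ => Nat.le_succ _

lemma le_addNode (hT : IsVecTree T) (hL : Admissible T L) : L ≤ addNode T L i := by
  intro h
  by_cases hi : T i (L i) = T h (L i)
  · rw [addNode, graft_of_glued hi, hL.eq_of_glued hT hi]
    exact Nat.le_succ _
  · rw [addNode, graft_of_not_glued hi]

lemma lt_addNode (hT : IsVecTree T) (hL : Admissible T L) : L < addNode T L i :=
  Pi.lt_def.2 ⟨le_addNode hT hL, i, addNode_apply_self (T := T) ▸ Nat.lt_succ_self _⟩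

lemma addNode_le (hK : Admissible T K) (hLK : L ≤ K) (hi : L i < K i) :
    addNode T L i ≤ K := by
  intro h
  by_cases hj : T i (L i) = T h (L i)
  · rw [addNode, graft_of_glued hj]
    exact hK i h _ hj hi
  · rw [addNode, graft_of_not_glued hj]
    exact hLK h

lemma nodes_addNode (hT : IsVecTree T) (hL : Admissible T L) :
    nodes T (addNode T L i) = insert (L i, T i (L i)) (nodes T L) := by
  ext ⟨j, v⟩
  rw [Finset.mem_insert]
  constructor
  · rw [mem_nodes]
    rintro ⟨h, hj, rfl⟩
    by_cases hi : T i (L i) = T h (L i)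
    · rw [addNode, graft_of_glued hi] at hj
      rcases (Nat.lt_succ_iff.1 hj).eq_or_lt with rfl | hlt
      · exact Or.inl (by rw [hi])
      · exact Or.inr (hL.mem_nodes_iff.2 (by rwa [hL.eq_of_glued hT hi]))
    · rw [addNode, graft_of_not_glued hi] at hj
      exact Or.inr (hL.mem_nodes_iff.2 hj)
  · rintro (hx | hx)
    · rw [hx, (admissible_addNode hT hL).mem_nodes_iff, addNode_apply_self]
      exact Nat.lt_succ_self _
    · exact nodes_mono (le_addNode hT hL) hx

end

/-! ### The semigroup of a multiplicity tree -/

namespace IsMultiplicityTreeOf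

variable {r : ℕ} {T : VecTree r} {S : AddSubmonoid (Fin r → ℕ)} {L v : Fin r → ℕ}

lemma mem_iff (hS : IsMultiplicityTreeOf T S) : v ∈ S ↔ ∃ L, Admissible T L ∧ treeSum T L = v := by
  rw [← hS.1.mem_subtreeSums_iff, ← hS.2, SetLike.mem_coe]

lemma treeSum_mem_iff (hS : IsMultiplicityTreeOf T S) : treeSum T L ∈ S ↔ Admissible T L :=
  hS.mem_iff.trans ⟨fun ⟨_, hK, h⟩ => hS.1.treeSum_injective h ▸ hK, fun hL => ⟨L, hL, rfl⟩⟩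

lemma inf_mem (hS : IsMultiplicityTreeOf T S) : ∀ a ∈ S, ∀ b ∈ S, a ⊓ b ∈ S := by
  intro a ha b hb
  obtain ⟨A, hA, rfl⟩ := hS.mem_iff.1 ha
  obtain ⟨B, hB, rfl⟩ := hS.mem_iff.1 hb
  exact hS.mem_iff.2 ⟨A ⊓ B, hA.inf hB, hS.1.treeSum_inf A B⟩

lemma exchange (hS : IsMultiplicityTreeOf T S) : ∀ a ∈ S, ∀ b ∈ S, ∀ i, a i = b i →
    ∃ c ∈ S, a i < c i ∧ (∀ j, j ≠ i → min (a j) (b j) ≤ c j) ∧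
      ∀ j, a j ≠ b j → c j = min (a j) (b j) := by
  intro a ha b hb i hab
  obtain ⟨A, hA, rfl⟩ := hS.mem_iff.1 ha
  obtain ⟨B, hB, rfl⟩ := hS.mem_iff.1 hb
  have hABi : A i = B i := (hS.1.partialSum_strictMono i).injective hab
  have hinf : (A ⊓ B) i = A i := inf_eq_left.2 hABi.le
  refine ⟨treeSum T (addNode T (A ⊓ B) i),
    hS.treeSum_mem_iff.2 (admissible_addNode hS.1 (hA.inf hB)), ?_, fun j _ => ?_, fun j hj => ?_⟩
  · refine hS.1.partialSum_strictMono i ?_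
    rw [addNode_apply_self, hinf]
    exact Nat.lt_succ_self _
  · have := hS.1.treeSum_le_iff.2 (le_addNode hS.1 (hA.inf hB) (i := i)) j
    rwa [hS.1.treeSum_inf] at this
  · have hsep : T i ((A ⊓ B) i) ≠ T j ((A ⊓ B) i) := by
      rw [hinf]
      intro hglued
      refine hj (congrArg (partialSum (branchSeq T j)) ?_)
      rw [hA.eq_of_glued hS.1 hglued, hB.eq_of_glued hS.1 (hABi ▸ hglued), hABi]
    rw [treeSum, addNode, graft_of_not_glued hsep]
    exact congrFun (hS.1.treeSum_inf A B) j

lemma isLocal (hS : IsMultiplicityTreeOf T S) : IsLocal S := by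
  rintro a ha ⟨i, hi⟩
  obtain ⟨L, hL, rfl⟩ := hS.mem_iff.1 ha
  have hLi : L i = 0 := (hS.1.partialSum_strictMono i).injective hi
  have hL0 : L = 0 := funext fun h => by
    rw [hL.eq_of_glued hS.1 (by rw [hLi, hS.1.root i h]), hLi, Pi.zero_apply]
  rw [hL0]
  rfl

lemma hasSaturatedChain_iff (hS : IsMultiplicityTreeOf T S) (hL : Admissible T L) {m : ℕ} :
    HasSaturatedChain S 0 (treeSum T L) m ↔ (nodes T L).card = m := by
  let rank := Function.extend (treeSum T) (fun L => (nodes T L).card) 0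
  have rank_treeSum (K : Fin r → ℕ) : rank (treeSum T K) = (nodes T K).card :=
    hS.1.treeSum_injective.extend_apply _ _ K
  have hrank : IsRankFunction S rank := by
    constructor
    · intro a ha b hb hab
      obtain ⟨A, hA, rfl⟩ := hS.mem_iff.1 ha
      obtain ⟨B, hB, rfl⟩ := hS.mem_iff.1 hb
      rw [rank_treeSum, rank_treeSum]
      exact Finset.card_lt_card (hA.nodes_ssubset hB (hS.1.treeSum_lt_iff.1 hab))
    · intro a ha b hb hab
      obtain ⟨A, hA, rfl⟩ := hS.mem_iff.1 ha
      obtain ⟨B, hB, rfl⟩ := hS.mem_iff.1 hb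
      obtain ⟨hle, i, hi⟩ := Pi.lt_def.1 (hS.1.treeSum_lt_iff.1 hab)
      refine ⟨treeSum T (addNode T A i), hS.treeSum_mem_iff.2 (admissible_addNode hS.1 hA),
        hS.1.treeSum_lt_iff.2 (lt_addNode hS.1 hA),
        hS.1.treeSum_le_iff.2 (addNode_le hB hle hi), ?_⟩
      rw [rank_treeSum, rank_treeSum, nodes_addNode hS.1 hA,
        Finset.card_insert_of_notMem fun hx => (hA.mem_nodes_iff.1 hx).false]
  have rank_zero : rank 0 = 0 := (rank_treeSum 0).trans (by rw [nodes_zero, Finset.card_empty])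
  rw [hrank.hasSaturatedChain_iff S.zero_mem (hS.treeSum_mem_iff.2 hL) zero_le, rank_treeSum,
    rank_zero, zero_add]

end IsMultiplicityTreeOf

/-! ### Arf trees -/

/-- From the levels `L` on, the branches are pairwise separated and consist of unit vectors. For
the level vector `L` of a subtree this says that its sum lies above the conductor. -/
def IsUnitAbove {r : ℕ} (T : VecTree r) (L : Fin r → ℕ) : Prop :=
  ∀ i j, L i ≤ j → T i j = Pi.single i 1

/-- The trees which are the multiplicity tree of some local Arf good semigroup: they end in unit
vectors, and the nodes of each level are sums of the nodes of the next levels of a subtree. -/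
structure IsArfTree {r : ℕ} (T : VecTree r) : Prop extends IsVecTree T where
  eventually_single : ∃ N : ℕ, IsUnitAbove T fun _ => N
  exists_sum : ∀ j, ∃ K, Admissible T K ∧
    ∀ i, branchSeq T i j = ∑ l ∈ Finset.Ico (j + 1) (K i), branchSeq T i l

section

variable {r : ℕ} {T : VecTree r} {S : AddSubmonoid (Fin r → ℕ)} {K K₁ K₂ L v : Fin r → ℕ}
  {i h : Fin r} {j : ℕ}

namespace IsUnitAbove

lemma mono (hL : IsUnitAbove T L) (hLK : L ≤ K) : IsUnitAbove T K :=
  fun i j hj => hL i j ((hLK i).trans hj)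

lemma branchSeq_eq_one (hL : IsUnitAbove T L) (hj : L i ≤ j) : branchSeq T i j = 1 := by
  rw [branchSeq, hL i j hj, Pi.single_eq_same]

lemma eq_of_glued (hT : IsVecTree T) (hL : IsUnitAbove T L) (hj : L i ≤ j)
    (hih : T i j = T h j) : i = h := by
  by_contra hne
  refine (hT.support i j h).1 ?_ hih
  rw [hL i j hj, Pi.single_eq_of_ne' hne]

lemma admissible (hT : IsVecTree T) (hL : IsUnitAbove T L) (hLa : Admissible T L) (hLK : L ≤ K) :
    Admissible T K := by
  intro i h j hj hlt
  rcases lt_or_ge j (L i) with hjL | hLj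
  · exact (hLa i h j hj hjL).trans_le (hLK h)
  · exact hL.eq_of_glued hT hLj hj ▸ hlt

lemma treeSum_add (hL : IsUnitAbove T L) (v : Fin r → ℕ) : treeSum T (L + v) = treeSum T L + v :=
  funext fun i => partialSum_add_of_forall_eq_one (fun _ => hL.branchSeq_eq_one) (v i)

end IsUnitAbove

lemma IsMultiplicityTreeOf.isUnitAbove (hS : IsMultiplicityTreeOf T S) (hL : Admissible T L)
    (hcone : ∀ v, treeSum T L + v ∈ S) : IsUnitAbove T L := by
  intro i j hj
  have hmono := hS.1.partialSum_strictMono i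
  obtain ⟨K, hK, hKL⟩ := hS.mem_iff.1
    (hcone (Pi.single i (partialSum (branchSeq T i) j - treeSum T L i + 1)))
  have hKi : partialSum (branchSeq T i) (K i) = partialSum (branchSeq T i) j + 1 := by
    have h₁ : treeSum T K i = _ := congrFun hKL i
    have h₂ : treeSum T L i ≤ partialSum (branchSeq T i) j := hmono.monotone hj
    rw [Pi.add_apply, Pi.single_eq_same] at h₁
    rw [← treeSum, h₁]
    omega
  have hjK : j < K i := hmono.lt_iff_lt.1 (by omega)
  ext h
  rcases eq_or_ne h i with rfl | hne
  · have h₁ : partialSum (branchSeq T h) (j + 1) ≤ _ := hmono.monotone hjK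
    rw [hKi, partialSum_succ] at h₁
    have h₂ := hS.1.branchSeq_pos h j
    rw [Pi.single_eq_same]
    exact le_antisymm (Nat.le_of_add_le_add_left h₁) h₂
  · have hKh : K h = L h := by
      refine (hS.1.partialSum_strictMono h).injective ((congrFun hKL h).trans ?_)
      rw [Pi.add_apply, Pi.single_eq_of_ne hne, add_zero, treeSum]
    rw [Pi.single_eq_of_ne hne, hS.1.support]
    intro hglued
    exact hj.not_gt ((hL.lt_iff hglued).2 (hKh ▸ hK i h j hglued hjK))

lemma IsMultiplicityTreeOf.isArfTree (hS : IsMultiplicityTreeOf T S) (hA : IsLocalArfGood S) :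
    IsArfTree T where
  toIsVecTree := hS.1
  eventually_single := by
    obtain ⟨δ, hδ, hcone⟩ := hA.good.exists_conductor
    obtain ⟨D, hD, rfl⟩ := hS.mem_iff.1 hδ
    exact ⟨Finset.univ.sup D, (hS.isUnitAbove hD hcone).mono fun i =>
      Finset.le_sup (Finset.mem_univ i)⟩
  exists_sum j := by
    have hlevel : treeSum T (fun _ => j) + (branchSeq T · j) = treeSum T fun _ => j + 1 :=
      funext fun i => (partialSum_succ _ _).symm
    have hmem : treeSum T (fun _ => j) + (branchSeq T · j) ∈ S :=
      hlevel ▸ hS.treeSum_mem_iff.2 (admissible_const _)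
    obtain ⟨K, hK, hsum⟩ := hS.mem_iff.1
      (hA.arf _ (hS.treeSum_mem_iff.2 (admissible_const j)) _ _ hmem hmem)
    rw [← add_assoc, hlevel] at hsum
    exact ⟨K, hK, fun i => (eq_sum_Ico_iff (hS.1.branchSeq_pos i j)).2 (congrFun hsum i)⟩

lemma IsArfTree.exists_double (hT : IsArfTree T) (hL : Admissible T L) (i : Fin r) :
    ∃ B, Admissible T B ∧ addNode T L i ≤ B ∧
      treeSum T (addNode T L i) + treeSum T (addNode T L i) = treeSum T B + treeSum T L := by
  obtain ⟨K, hK, hsum⟩ := hT.exists_sum (L i)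
  have hKL (h : Fin r) : partialSum (branchSeq T h) (K h) =
      partialSum (branchSeq T h) (L i + 1) + branchSeq T h (L i) :=
    (eq_sum_Ico_iff (hT.branchSeq_pos h _)).1 (hsum h)
  have hlt (h : Fin r) : L i < K h :=
    (hT.partialSum_strictMono h).le_iff_le.1 ((Nat.le_add_right _ _).trans (hKL h).ge)
  have hB : treeSum T (addNode T L i) + treeSum T (addNode T L i) =
      treeSum T (graft T L i K) + treeSum T L := by
    ext h
    simp only [Pi.add_apply, treeSum]
    by_cases hi : T i (L i) = T h (L i)
    · rw [addNode, graft_of_glued hi, graft_of_glued hi, hL.eq_of_glued hT.toIsVecTree hi, hKL,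
        partialSum_succ]
      ring
    · rw [addNode, graft_of_not_glued hi, graft_of_not_glued hi]
  refine ⟨graft T L i K, admissible_graft hT.toIsVecTree hL hK fun h _ => (hlt h).le,
    hT.treeSum_le_iff.1 ?_, hB⟩
  refine le_of_add_le_add_right (a := treeSum T L) (hB ▸ ?_)
  exact add_le_add_right (hT.treeSum_le_iff.2 (le_addNode hT.toIsVecTree hL)) _

lemma IsVecTree.exists_add_of_isUnitAbove (hT : IsVecTree T) {N : ℕ} (hN : IsUnitAbove T fun _ => N)
    (hL : Admissible T L) (hK₁ : Admissible T K₁) (hK₂ : Admissible T K₂) (hLK₁ : L ≤ K₁)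
    (hLK₂ : L ≤ K₂) (h : ∀ i, N ≤ L i ∨ L i = K₁ i ∨ L i = K₂ i) :
    ∃ C, Admissible T C ∧ treeSum T K₁ + treeSum T K₂ = treeSum T C + treeSum T L := by
  refine ⟨K₁ + (K₂ - L), fun i i' j hj hlt => ?_, funext fun i => ?_⟩
  · rcases le_or_gt N j with hNj | hjN
    · exact hN.eq_of_glued hT hNj hj ▸ hlt
    have : L i ≤ K₁ i := hLK₁ i
    have : L i' ≤ K₁ i' := hLK₁ i'
    have : L i' ≤ K₂ i' := hLK₂ i'
    have := hL i i' j hj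
    have := hK₁ i i' j hj
    have := hK₂ i i' j hj
    have := h i
    simp only [Pi.add_apply, Pi.sub_apply] at hlt ⊢
    omega
  · simp only [Pi.add_apply, Pi.sub_apply, treeSum]
    rcases h i with hNL | hLK | hLK
    · have partialSum_add (d : ℕ) :
          partialSum (branchSeq T i) (L i + d) = partialSum (branchSeq T i) (L i) + d :=
        partialSum_add_of_forall_eq_one (fun j hj => hN.branchSeq_eq_one (hNL.trans hj)) d
      obtain ⟨d₁, hd₁⟩ := Nat.exists_eq_add_of_le (hLK₁ i)
      obtain ⟨d₂, hd₂⟩ := Nat.exists_eq_add_of_le (hLK₂ i)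
      rw [hd₁, hd₂, Nat.add_sub_cancel_left, add_assoc]
      simp only [partialSum_add]
      ring
    · rw [← hLK, Nat.add_sub_cancel' (hLK₂ i), add_comm]
    · rw [hLK, Nat.sub_self, add_zero]

lemma IsArfTree.exists_add (hT : IsArfTree T) (hL : Admissible T L) (hK₁ : Admissible T K₁)
    (hK₂ : Admissible T K₂) (hLK₁ : L ≤ K₁) (hLK₂ : L ≤ K₂) :
    ∃ C, Admissible T C ∧ treeSum T K₁ + treeSum T K₂ = treeSum T C + treeSum T L := by
  obtain ⟨N, hN⟩ := hT.eventually_single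
  -- Writing `L⁺` for `L` with one more node and identifying level vectors with their sums,
  -- `K₁ + K₂ - L = ((K₁ + K₂ - L⁺) + (2 L⁺ - L)) - L⁺`, where both bracketed sums lie above `L⁺`.
  induction hm : ∑ i, (N - L i) using Nat.strong_induction_on generalizing L K₁ K₂ with
  | _ m ih =>
    subst hm
    by_cases! h : ∀ i, N ≤ L i ∨ L i = K₁ i ∨ L i = K₂ i
    · exact hT.exists_add_of_isUnitAbove hN hL hK₁ hK₂ hLK₁ hLK₂ h
    obtain ⟨i, hiN, hi₁, hi₂⟩ := h
    have hL' := admissible_addNode hT.toIsVecTree hL (i := i)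
    have hLL' := le_addNode hT.toIsVecTree hL (i := i)
    have hdecr : ∑ h, (N - addNode T L i h) < ∑ h, (N - L h) := by
      refine Finset.sum_lt_sum (fun h _ => Nat.sub_le_sub_left (hLL' h) N)
        ⟨i, Finset.mem_univ i, ?_⟩
      rw [addNode_apply_self]
      omega
    have hle₁ := addNode_le hK₁ hLK₁ ((hLK₁ i).lt_of_ne hi₁)
    have hle₂ := addNode_le hK₂ hLK₂ ((hLK₂ i).lt_of_ne hi₂)
    obtain ⟨A, hA, hKA⟩ := ih _ hdecr hL' hK₁ hK₂ hle₁ hle₂ rfl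
    obtain ⟨B, hB, hLB, hBL⟩ := hT.exists_double hL i
    have hLA : addNode T L i ≤ A := by
      refine hT.treeSum_le_iff.1 (le_of_add_le_add_right (a := treeSum T (addNode T L i)) ?_)
      rw [← hKA]
      exact add_le_add (hT.treeSum_le_iff.2 hle₁) (hT.treeSum_le_iff.2 hle₂)
    obtain ⟨C, hC, hAC⟩ := ih _ hdecr hL' hA hB hLA hLB rfl
    refine ⟨C, hC, add_right_cancel (b := treeSum T B) ?_⟩
    calc treeSum T K₁ + treeSum T K₂ + treeSum T B
        = treeSum T A + treeSum T B + treeSum T (addNode T L i) := by rw [hKA]; abel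
      _ = treeSum T C + (treeSum T (addNode T L i) + treeSum T (addNode T L i)) := by
        rw [hAC]; abel
      _ = treeSum T C + treeSum T L + treeSum T B := by rw [hBL]; abel

/-- The local Arf good semigroup with multiplicity tree `T`. -/
def IsArfTree.semigroup (hT : IsArfTree T) : AddSubmonoid (Fin r → ℕ) where
  carrier := subtreeSums T
  zero_mem' := Or.inl rfl
  add_mem' := by
    intro a b ha hb
    obtain ⟨A, hA, rfl⟩ := hT.mem_subtreeSums_iff.1 ha
    obtain ⟨B, hB, rfl⟩ := hT.mem_subtreeSums_iff.1 hb
    obtain ⟨C, hC, hsum⟩ := hT.exists_add (admissible_const 0) hA hB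
      (fun _ => Nat.zero_le _) (fun _ => Nat.zero_le _)
    exact hT.mem_subtreeSums_iff.2 ⟨C, hC, hsum.symm⟩

lemma IsArfTree.isMultiplicityTreeOf (hT : IsArfTree T) : IsMultiplicityTreeOf T hT.semigroup :=
  ⟨hT.toIsVecTree, rfl⟩

lemma IsArfTree.isLocalArfGood (hT : IsArfTree T) : IsLocalArfGood hT.semigroup := by
  have hS := hT.isMultiplicityTreeOf
  refine ⟨⟨hS.inf_mem, hS.exchange, ?_⟩, hS.isLocal, fun α hα x y hx hy => ?_⟩
  · obtain ⟨N, hN⟩ := hT.eventually_single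
    refine ⟨treeSum T fun _ => N, hS.treeSum_mem_iff.2 (admissible_const N), fun v => ?_⟩
    rw [← hN.treeSum_add, hS.treeSum_mem_iff]
    exact hN.admissible hT.toIsVecTree (admissible_const N) le_self_add
  · obtain ⟨A, hA, rfl⟩ := hS.mem_iff.1 hα
    obtain ⟨X, hX, hAX⟩ := hS.mem_iff.1 hx
    obtain ⟨Y, hY, hAY⟩ := hS.mem_iff.1 hy
    obtain ⟨C, hC, hsum⟩ := hT.exists_add hA hX hY
      (hT.treeSum_le_iff.1 (hAX ▸ le_self_add)) (hT.treeSum_le_iff.1 (hAY ▸ le_self_add))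
    refine hS.mem_iff.2 ⟨C, hC, add_right_cancel (b := treeSum T A) ?_⟩
    rw [← hsum, hAX, hAY]
    abel

end

/-! ### The genus of a multiplicity tree -/

/-- The sum of `|𝐧| - 1` over the nodes `𝐧` of the subtree with level vector `L`, where `|𝐧|` is
the sum of the coordinates. -/
def nodeGenus {r : ℕ} (T : VecTree r) (L : Fin r → ℕ) : ℕ :=
  ∑ x ∈ nodes T L, (∑ i, x.2 i - 1)

section

variable {r n : ℕ} {T : VecTree r} {S : AddSubmonoid (Fin r → ℕ)} {K L : Fin r → ℕ}

lemma IsVecTree.nodeGenus_add_card_nodes (hT : IsVecTree T) (hL : Admissible T L) :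
    nodeGenus T L + (nodes T L).card = ∑ i, treeSum T L i := by
  have sum_pos : ∀ x ∈ nodes T L, 1 ≤ ∑ i, x.2 i := by
    rintro ⟨j, v⟩ hx
    obtain ⟨i, -, rfl⟩ := mem_nodes.1 hx
    exact (hT.branchSeq_pos i j).trans_le
      (Finset.single_le_sum (f := T i j) (fun _ _ => Nat.zero_le _) (Finset.mem_univ i))
  calc nodeGenus T L + (nodes T L).card
      = ∑ x ∈ nodes T L, (∑ i, x.2 i - 1 + 1) := by
        rw [Finset.sum_add_distrib, Finset.card_eq_sum_ones, nodeGenus]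
    _ = ∑ x ∈ nodes T L, ∑ i, x.2 i :=
        Finset.sum_congr rfl fun x hx => Nat.sub_add_cancel (sum_pos x hx)
    _ = ∑ i, treeSum T L i := by
        rw [Finset.sum_comm, ← hT.sum_nodes hL]
        simp only [Finset.sum_apply]

lemma IsUnitAbove.nodeGenus_eq_of_le (hL : IsUnitAbove T L) (hLK : L ≤ K) :
    nodeGenus T K = nodeGenus T L := by
  refine (Finset.sum_subset (nodes_mono hLK) ?_).symm
  rintro ⟨j, v⟩ hx hxL
  obtain ⟨i, -, rfl⟩ := mem_nodes.1 hx
  have hLj : L i ≤ j := not_lt.1 fun hlt => hxL (mem_nodes.2 ⟨i, hlt, rfl⟩)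
  simp only [hL i j hLj, Finset.sum_pi_single', Finset.mem_univ, if_true, Nat.sub_self]

lemma IsUnitAbove.nodeGenus_eq (hK : IsUnitAbove T K) (hL : IsUnitAbove T L) :
    nodeGenus T K = nodeGenus T L :=
  (hK.nodeGenus_eq_of_le le_sup_left).symm.trans (hL.nodeGenus_eq_of_le le_sup_right)

lemma IsMultiplicityTreeOf.hasGenus_iff (hS : IsMultiplicityTreeOf T S) (hgood : IsGoodSemigroup S)
    (hL : IsUnitAbove T L) : HasGenus S n ↔ nodeGenus T L = n := by
  have chains_iff {δ : Fin r → ℕ} (hδ : IsConductor S δ) : ∃ c, nodeGenus T L + c = ∑ i, δ i ∧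
      ∀ {m}, (HasSaturatedChain S 0 δ m ↔ c = m) := by
    obtain ⟨D, hD, rfl⟩ := hS.mem_iff.1 (by simpa using hδ.1 0)
    refine ⟨(nodes T D).card, ?_, hS.hasSaturatedChain_iff hD⟩
    rw [hL.nodeGenus_eq (hS.isUnitAbove hD hδ.1), hS.1.nodeGenus_add_card_nodes hD]
  have top_chain_iff {δ : Fin r → ℕ} {m : ℕ} : HasSaturatedChain ⊤ 0 δ m ↔ ∑ i, δ i = m := by
    rw [isRankFunction_top_sum.hasSaturatedChain_iff trivial trivial zero_le]
    simp
  constructor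
  · rintro ⟨δ, m₁, m₂, hδ, h₁, h₂, hn⟩
    obtain ⟨c, hc, hchain⟩ := chains_iff hδ
    rw [hchain] at h₂
    rw [top_chain_iff] at h₁
    omega
  · intro hn
    obtain ⟨δ, hδ⟩ := hgood.exists_isConductor
    obtain ⟨c, hc, hchain⟩ := chains_iff hδ
    exact ⟨δ, _, c, hδ, top_chain_iff.2 rfl, hchain.2 rfl, by omega⟩

lemma mem_gen_iff : T ∈ Gen r n ↔
    IsUntwisted T ∧ IsArfTree T ∧ ∃ L, IsUnitAbove T L ∧ nodeGenus T L = n := by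
  refine and_congr_right fun _ => ⟨fun ⟨S, hA, hS, hn⟩ => ?_, fun ⟨hT, L, hL, hn⟩ => ?_⟩
  · have hT := hS.isArfTree hA
    obtain ⟨N, hN⟩ := hT.eventually_single
    exact ⟨hT, _, hN, (hS.hasGenus_iff hA.good hN).1 hn⟩
  · exact ⟨hT.semigroup, hT.isLocalArfGood, hT.isMultiplicityTreeOf,
      (hT.isMultiplicityTreeOf.hasGenus_iff hT.isLocalArfGood.good hL).2 hn⟩

end

/-! ### Untwisted trees -/

section

variable {r : ℕ} {T : VecTree r}

lemma IsUntwisted.admissible_iff (hT : IsUntwisted T) {L : Fin r → ℕ} :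
    Admissible T L ↔ ∀ k : Fin (r - 1), ∀ j, T ⟨k, by omega⟩ j = T ⟨k + 1, by omega⟩ j →
      (j < L ⟨k, by omega⟩ ↔ j < L ⟨k + 1, by omega⟩) := by
  refine ⟨fun hL k j hj => hL.lt_iff hj, fun H => ?_⟩
  have lt_iff_of_le (i : Fin r) (j m : ℕ) (him : (i : ℕ) ≤ m) :
      ∀ hm : m < r, T i j = T ⟨m, hm⟩ j → (j < L i ↔ j < L ⟨m, hm⟩) := by
    induction m, him using Nat.le_induction with
    | base => exact fun _ _ => Iff.rfl
    | succ m him ih =>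
      intro hm hj
      have hlast : T ⟨m, by omega⟩ j = T ⟨m + 1, hm⟩ j :=
        (hT i ⟨m + 1, hm⟩ (Nat.lt_succ_of_le him) j).1 hj m hm him (Nat.lt_succ_self m)
      rw [ih (by omega) (hj.trans hlast.symm)]
      exact H ⟨m, by omega⟩ j hlast
  intro i h j hj
  rcases le_total i h with hih | hih
  · exact (lt_iff_of_le i j h hih h.2 hj).1
  · exact (lt_iff_of_le h j i hih i.2 hj.symm).2

lemma IsUntwisted.card_level_add_card_glued (hT : IsUntwisted T) (j : ℕ) :
    (Finset.univ.image (T · j)).card + (Finset.univ.filter fun k : Fin (r - 1) =>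
      T ⟨k, by omega⟩ j = T ⟨k + 1, by omega⟩ j).card = r := by
  -- The branches that are not glued to their successor represent the nodes of the level.
  set glued := (Finset.univ.filter fun k : Fin (r - 1) =>
    T ⟨k, by omega⟩ j = T ⟨k + 1, by omega⟩ j).map (Fin.castLEEmb (Nat.sub_le r 1)) with hglued
  have mem_glued (i : Fin r) :
      i ∈ glued ↔ ∃ hi : (i : ℕ) + 1 < r, T i j = T ⟨i + 1, hi⟩ j := by
    simp only [hglued, Finset.mem_map, Finset.mem_filter, Finset.mem_univ, true_and]
    constructor
    · rintro ⟨k, hk, rfl⟩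
      exact ⟨by simp only [Fin.castLEEmb_apply, Fin.val_castLE]; omega, hk⟩
    · rintro ⟨hi, hij⟩
      exact ⟨⟨i, by omega⟩, hij, rfl⟩
  have himage : Finset.univ.image (T · j) = gluedᶜ.image (T · j) := by
    refine (Finset.image_subset_iff.2 fun i _ => ?_).antisymm
      (Finset.image_subset_image (Finset.subset_univ _))
    obtain ⟨h, hh, hmax⟩ := (Finset.univ.filter (T · j = T i j)).exists_max_image id
      ⟨i, Finset.mem_filter.2 ⟨Finset.mem_univ i, rfl⟩⟩
    have hhi : T h j = T i j := (Finset.mem_filter.1 hh).2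
    refine Finset.mem_image.2 ⟨h, Finset.mem_compl.2 fun hmem => ?_, hhi⟩
    obtain ⟨hlt, hsucc⟩ := (mem_glued h).1 hmem
    exact (Nat.lt_succ_self h).not_ge (hmax ⟨h + 1, hlt⟩
      (Finset.mem_filter.2 ⟨Finset.mem_univ _, hsucc.symm.trans hhi⟩))
  have hinj : Set.InjOn (T · j) (gluedᶜ : Finset (Fin r)) := by
    have le_of_eq {i h : Fin r} (hi : i ∉ glued) (hih : T i j = T h j) : h ≤ i :=
      not_lt.1 fun hlt => hi ((mem_glued i).2
        ⟨lt_of_le_of_lt hlt h.2, (hT i h hlt j).1 hih i _ le_rfl hlt⟩)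
    intro i hi h hh hih
    simp only [Finset.coe_compl, Set.mem_compl_iff, Finset.mem_coe] at hi hh
    exact le_antisymm (le_of_eq hh hih.symm) (le_of_eq hi hih)
  rw [himage, Finset.card_image_of_injOn hinj, ← Finset.card_map (Fin.castLEEmb (Nat.sub_le r 1)),
    ← hglued, Finset.card_compl_add_card, Fintype.card_fin]

lemma card_nodes_const (T : VecTree r) (N : ℕ) :
    (nodes T fun _ => N).card = ∑ j ∈ Finset.range N, (Finset.univ.image (T · j)).card := by
  have hmaps : Set.MapsTo Prod.fst (nodes T fun _ => N : Set (ℕ × (Fin r → ℕ)))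
      (Finset.range N) := fun ⟨_, _⟩ hx =>
    have ⟨_, hlt, _⟩ := mem_nodes.1 hx
    Finset.mem_coe.2 (Finset.mem_range.2 hlt)
  rw [Finset.card_eq_sum_card_fiberwise hmaps]
  refine Finset.sum_congr rfl fun j hj => ?_
  have hlevel : (nodes T fun _ => N).filter (fun x => x.1 = j) =
      (Finset.univ.image (T · j)).map ⟨fun v => (j, v), Prod.mk_right_injective j⟩ := by
    ext ⟨l, v⟩
    simp only [Finset.mem_filter, mem_nodes, Finset.mem_map, Finset.mem_image, Finset.mem_univ,
      true_and, Function.Embedding.coeFn_mk, Prod.mk.injEq]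
    constructor
    · rintro ⟨⟨i, -, rfl⟩, rfl⟩
      exact ⟨_, ⟨i, rfl⟩, rfl, rfl⟩
    · rintro ⟨_, ⟨i, rfl⟩, rfl, rfl⟩
      exact ⟨⟨i, Finset.mem_range.1 hj, rfl⟩, rfl⟩
  rw [hlevel, Finset.card_map]

end

/-! ### Trees given by sequences and gluing levels -/

/-- The condition under which the branches `i` and `h` of `treeOf E q` are glued on the level with
index `j`. -/
def Glued {r : ℕ} (q : Fin (r - 1) → ℕ) (i h : Fin r) (j : ℕ) : Prop :=
  ∀ k : Fin (r - 1), min (i : ℕ) h ≤ k → (k : ℕ) < max (i : ℕ) h → j + 1 ≤ q k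

/-- The conditions on the sequences `E` and the gluing levels `q` under which `treeOf E q` is the
multiplicity tree of a local Arf good semigroup. -/
structure IsGluingData {r : ℕ} (E : Fin r → ℕ → ℕ) (q : Fin (r - 1) → ℕ) : Prop where
  isMultSeq : ∀ i, IsMultSeq (E i)
  one_le : ∀ k, 1 ≤ q k
  le_comp : ∀ k : Fin (r - 1), (q k : ℕ∞) ≤ Comp (E ⟨k, by omega⟩) (E ⟨k + 1, by omega⟩)

/-- The genus of the local Arf good semigroup with multiplicity tree `treeOf E q`. -/
noncomputable def gluingGenus {r : ℕ} (E : Fin r → ℕ → ℕ) (q : Fin (r - 1) → ℕ) : ℕ :=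
  ∑ i, seqGenus (E i) + ∑ k, q k

section

variable {r n N : ℕ} {E : Fin r → ℕ → ℕ} {q : Fin (r - 1) → ℕ} {T : VecTree r} {i h x : Fin r}
  {j : ℕ}

lemma Glued.refl (i : Fin r) (j : ℕ) : Glued q i i j := fun k _ _ => by omega

lemma Glued.symm (hih : Glued q i h j) : Glued q h i j :=
  fun k h₁ h₂ => hih k (by omega) (by omega)

lemma Glued.trans (hih : Glued q i h j) (hhx : Glued q h x j) : Glued q i x j := by
  intro k h₁ h₂
  by_cases hk : min (i : ℕ) h ≤ k ∧ (k : ℕ) < max (i : ℕ) h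
  · exact hih k hk.1 hk.2
  · exact hhx k (by omega) (by omega)

lemma glued_succ_iff {k : Fin (r - 1)} : Glued q ⟨k, by omega⟩ ⟨k + 1, by omega⟩ j ↔ j < q k := by
  refine ⟨fun hk => hk k (by simp) (by simp), fun hj l h₁ h₂ => ?_⟩
  obtain rfl : l = k := Fin.ext (by simp only at h₁ h₂; omega)
  exact hj

lemma glued_iff_of_lt (hih : i < h) : Glued q i h j ↔
    ∀ (k : ℕ) (hk : k + 1 < r), (i : ℕ) ≤ k → k < (h : ℕ) → j < q ⟨k, by omega⟩ := by
  have : (i : ℕ) < h := hih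
  exact ⟨fun hg k hk h₁ h₂ => hg ⟨k, by omega⟩ (by simp only; omega) (by simp only; omega),
    fun H k h₁ h₂ => H k (by omega) (by omega) (by omega)⟩

lemma treeOf_apply_of_glued (hih : Glued q i h j) : treeOf E q i j h = E h j := if_pos hih

lemma treeOf_apply_of_not_glued (hih : ¬Glued q i h j) : treeOf E q i j h = 0 := if_neg hih

lemma branchSeq_treeOf (i : Fin r) : branchSeq (treeOf E q) i = E i :=
  funext fun j => treeOf_apply_of_glued (Glued.refl i j)

lemma treeOf_eq_iff (hE : ∀ i j, 0 < E i j) :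
    treeOf E q i j = treeOf E q h j ↔ Glued q i h j := by
  constructor
  · intro heq
    by_contra hih
    have hzero : E h j = 0 := by
      rw [← treeOf_apply_of_glued (E := E) (Glued.refl (q := q) h j), ← heq,
        treeOf_apply_of_not_glued hih]
    exact (hE h j).ne' hzero
  · intro hih
    ext x
    by_cases hx : Glued q h x j
    · rw [treeOf_apply_of_glued hx, treeOf_apply_of_glued (hih.trans hx)]
    · rw [treeOf_apply_of_not_glued hx,
        treeOf_apply_of_not_glued fun hx' => hx (hih.symm.trans hx')]

lemma isUntwisted_treeOf (hE : ∀ i j, 0 < E i j) : IsUntwisted (treeOf E q) := by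
  intro i h hih j
  rw [treeOf_eq_iff hE, glued_iff_of_lt hih]
  exact forall₄_congr fun k hk _ _ => by
    rw [treeOf_eq_iff hE, glued_succ_iff (k := ⟨k, by omega⟩)]

lemma isVecTree_treeOf (hE : ∀ i j, 0 < E i j) (hq : ∀ k, 1 ≤ q k) :
    IsVecTree (treeOf E q) where
  root i h := (treeOf_eq_iff hE).2 fun k _ _ => hq k
  parent i h j hj := (treeOf_eq_iff hE).2 fun k h₁ h₂ =>
    Nat.le_of_succ_le ((treeOf_eq_iff hE).1 hj k h₁ h₂)
  support i j h := by
    rw [Ne, treeOf_eq_iff hE]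
    refine ⟨fun hzero hih => ?_, treeOf_apply_of_not_glued⟩
    rw [treeOf_apply_of_glued hih] at hzero
    exact (hE h j).ne' hzero

lemma IsVecTree.eq_treeOf (hT : IsVecTree T) (hu : IsUntwisted T)
    (hq : ∀ (k : Fin (r - 1)) j, T ⟨k, by omega⟩ j = T ⟨k + 1, by omega⟩ j ↔ j < q k) :
    T = treeOf (branchSeq T) q := by
  have glued_iff_of_lt' {i h : Fin r} (hih : i < h) (j : ℕ) : T i j = T h j ↔ Glued q i h j := by
    rw [hu i h hih, glued_iff_of_lt hih]
    exact forall₄_congr fun k hk _ _ => hq ⟨k, by omega⟩ j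
  have glued_iff (i h : Fin r) (j : ℕ) : T i j = T h j ↔ Glued q i h j := by
    rcases lt_trichotomy i h with hih | rfl | hih
    · exact glued_iff_of_lt' hih j
    · exact iff_of_true rfl (Glued.refl i j)
    · rw [eq_comm, glued_iff_of_lt' hih]
      exact ⟨Glued.symm, Glued.symm⟩
  ext i j h
  by_cases hih : T i j = T h j
  · rw [treeOf_apply_of_glued ((glued_iff i h j).1 hih), hih, branchSeq]
  · rw [treeOf_apply_of_not_glued (mt (glued_iff i h j).2 hih), hT.support]
    exact hih

lemma IsVecTree.exists_glued_iff_lt (hT : IsVecTree T) (hN : IsUnitAbove T fun _ => N)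
    (hne : i ≠ h) : ∃ p, ∀ j, T i j = T h j ↔ j < p := by
  have hlower : IsLowerSet {j | T i j = T h j} :=
    fun _ _ hle hih => hT.antitone_glued i h hle hih
  obtain ⟨p, hp⟩ := hlower.eq_univ_or_Iio.resolve_left fun huniv =>
    hne (hN.eq_of_glued hT le_rfl (huniv.ge (Set.mem_univ N)))
  exact ⟨p, Set.ext_iff.1 hp⟩

lemma IsVecTree.exists_eq_treeOf (hT : IsVecTree T) (hu : IsUntwisted T)
    (hN : IsUnitAbove T fun _ => N) : ∃ E q, T = treeOf E q := by
  choose q hq using fun k : Fin (r - 1) =>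
    hT.exists_glued_iff_lt hN (i := ⟨k, by omega⟩) (h := ⟨k + 1, by omega⟩) (by simp)
  exact ⟨branchSeq T, q, hT.eq_treeOf hu hq⟩

lemma admissible_treeOf_iff (hE : ∀ i j, 0 < E i j) {L : Fin r → ℕ} :
    Admissible (treeOf E q) L ↔
      ∀ k : Fin (r - 1), min (L ⟨k, by omega⟩) (q k) = min (L ⟨k + 1, by omega⟩) (q k) := by
  rw [(isUntwisted_treeOf hE).admissible_iff]
  refine forall_congr' fun k => ?_
  simp only [treeOf_eq_iff hE, glued_succ_iff]
  refine ⟨fun H => eq_of_forall_lt_iff fun j => ?_, fun H j hj => ?_⟩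
  · rw [lt_min_iff, lt_min_iff]
    exact and_congr_left (H j)
  · omega

lemma isUnitAbove_treeOf_iff : IsUnitAbove (treeOf E q) (fun _ => N) ↔
    (∀ i j, N ≤ j → E i j = 1) ∧ ∀ k, q k ≤ N := by
  constructor
  · intro hN
    have hone (i : Fin r) (j : ℕ) (hj : N ≤ j) : E i j = 1 :=
      branchSeq_treeOf (E := E) (q := q) i ▸ hN.branchSeq_eq_one hj
    refine ⟨hone, fun k => not_lt.1 fun hlt => ?_⟩
    have := congrFun (hN ⟨k, by omega⟩ N le_rfl) ⟨k + 1, by omega⟩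
    rw [treeOf_apply_of_glued (glued_succ_iff.2 hlt), hone _ _ le_rfl] at this
    simp at this
  · rintro ⟨hone, hq⟩ i j hj
    ext h
    rcases eq_or_ne h i with rfl | hne
    · rw [treeOf_apply_of_glued (Glued.refl h j), hone h j hj, Pi.single_eq_same]
    · rw [Pi.single_eq_of_ne hne, treeOf_apply_of_not_glued]
      intro hglued
      have := Fin.val_ne_of_ne hne
      have hlt := hglued ⟨min (i : ℕ) h, by omega⟩ le_rfl (by simp only; omega)
      exact (hlt.trans (hq _)).not_gt (Nat.lt_succ_of_le hj)

lemma isArfTree_treeOf_iff : IsArfTree (treeOf E q) ↔ IsGluingData E q := by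
  constructor
  · intro hT
    have hE (i : Fin r) (j : ℕ) : 0 < E i j :=
      branchSeq_treeOf (E := E) (q := q) i ▸ hT.branchSeq_pos i j
    obtain ⟨N, hN⟩ := hT.eventually_single
    have exists_admissible (j : ℕ) : ∃ K, Admissible (treeOf E q) K ∧
        ∀ i, E i j = ∑ l ∈ Finset.Ico (j + 1) (K i), E i l := by
      simpa only [branchSeq_treeOf] using hT.exists_sum j
    refine ⟨fun i => ⟨hE i, ⟨N, (isUnitAbove_treeOf_iff.1 hN).1 i⟩, fun j => ?_⟩, fun k => ?_,
      fun k => le_comp_iff.2 fun j => ?_⟩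
    · obtain ⟨K, -, hK⟩ := exists_admissible j
      exact ⟨K i, hK i⟩
    · exact glued_succ_iff.1 ((treeOf_eq_iff hE).1 (hT.root _ _))
    · obtain ⟨K, hKa, hK⟩ := exists_admissible j
      rw [sumEnd_eq (hE _) (hK _), sumEnd_eq (hE _) (hK _)]
      exact (admissible_treeOf_iff hE).1 hKa k
  · intro hEq
    have hE (i : Fin r) : ∀ j, 0 < E i j := (hEq.isMultSeq i).pos
    choose N hN using fun i => (hEq.isMultSeq i).eventually_one
    refine ⟨isVecTree_treeOf hE hEq.one_le, ⟨max (Finset.univ.sup N) (Finset.univ.sup q),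
      isUnitAbove_treeOf_iff.2 ⟨fun i j hj => hN i j ?_, fun k => ?_⟩⟩, fun j =>
      ⟨fun i => sumEnd (E i) j, (admissible_treeOf_iff hE).2 fun k =>
        le_comp_iff.1 (hEq.le_comp k) j, fun i => ?_⟩⟩
    · exact (Finset.le_sup (Finset.mem_univ i)).trans ((le_max_left _ _).trans hj)
    · exact (Finset.le_sup (Finset.mem_univ k)).trans (le_max_right _ _)
    · rw [branchSeq_treeOf]
      exact (hEq.isMultSeq i).eq_sum_sumEnd j

lemma card_nodes_treeOf (hE : ∀ i j, 0 < E i j) (hN : ∀ k, q k ≤ N) :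
    (nodes (treeOf E q) fun _ => N).card + ∑ k, q k = r * N := by
  have hq : ∑ k, q k = ∑ j ∈ Finset.range N, (Finset.univ.filter (j < q ·)).card := by
    simp only [Finset.card_filter]
    rw [Finset.sum_comm]
    refine Finset.sum_congr rfl fun k _ => ?_
    have : (Finset.range N).filter (· < q k) = Finset.range (q k) := by
      ext j
      have := hN k
      simp only [Finset.mem_filter, Finset.mem_range]
      omega
    rw [← Finset.card_filter, this, Finset.card_range]
  have card_level (j : ℕ) : (Finset.univ.image (treeOf E q · j)).card +
      (Finset.univ.filter (j < q ·)).card = r := by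
    simpa only [treeOf_eq_iff hE, glued_succ_iff] using
      (isUntwisted_treeOf (q := q) hE).card_level_add_card_glued j
  rw [card_nodes_const, hq, ← Finset.sum_add_distrib, Finset.sum_congr rfl fun j _ => card_level j,
    Finset.sum_const, Finset.card_range, smul_eq_mul, mul_comm]

lemma nodeGenus_treeOf (hT : IsVecTree (treeOf E q))
    (hN : IsUnitAbove (treeOf E q) fun _ => N) :
    nodeGenus (treeOf E q) (fun _ => N) = gluingGenus E q := by
  have hE (i : Fin r) (j : ℕ) : 0 < E i j :=
    branchSeq_treeOf (E := E) (q := q) i ▸ hT.branchSeq_pos i j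
  obtain ⟨hone, hq⟩ := isUnitAbove_treeOf_iff.1 hN
  have hsum : ∑ i, treeSum (treeOf E q) (fun _ => N) i = r * N + ∑ i, seqGenus (E i) := by
    simp only [treeSum, branchSeq_treeOf]
    rw [Finset.sum_congr rfl fun i _ => partialSum_eq_add_seqGenus (hE i) (hone i),
      Finset.sum_add_distrib, Finset.sum_const, Finset.card_univ, Fintype.card_fin, smul_eq_mul]
  have := hT.nodeGenus_add_card_nodes (admissible_const N)
  have := card_nodes_treeOf hE hq
  rw [gluingGenus]
  omega

lemma treeOf_mem_gen_iff : treeOf E q ∈ Gen r n ↔ IsGluingData E q ∧ gluingGenus E q = n := by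
  rw [mem_gen_iff, ← isArfTree_treeOf_iff]
  constructor
  · rintro ⟨-, hT, L, hL, hn⟩
    obtain ⟨N, hN⟩ := hT.eventually_single
    rw [← nodeGenus_treeOf hT.toIsVecTree hN, hN.nodeGenus_eq hL]
    exact ⟨hT, hn⟩
  · rintro ⟨hT, hn⟩
    obtain ⟨N, hN⟩ := hT.eventually_single
    exact ⟨isUntwisted_treeOf fun i => ((isArfTree_treeOf_iff.1 hT).isMultSeq i).pos, hT, _, hN,
      (nodeGenus_treeOf hT.toIsVecTree hN).trans hn⟩

lemma exists_eq_treeOf_of_mem_gen (hT : T ∈ Gen r n) : ∃ E q, T = treeOf E q := by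
  obtain ⟨hu, hArf, -⟩ := mem_gen_iff.1 hT
  obtain ⟨N, hN⟩ := hArf.eventually_single
  exact hArf.exists_eq_treeOf hu hN

end

/-! ### Cutting an untwisted tree between two consecutive branches -/

lemma sum_fin_eq_add {A : Type*} [AddCommMonoid A] {m a b : ℕ} (hm : m = a + b) (f : Fin m → A) :
    ∑ i, f i = ∑ i : Fin a, f ⟨i, by omega⟩ + ∑ i : Fin b, f ⟨a + i, by omega⟩ := by
  subst hm
  exact Fin.sum_univ_add f

section

variable {r n t : ℕ} {E : Fin r → ℕ → ℕ} {q : Fin (r - 1) → ℕ}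
  {T : VecTree r}

lemma isGluingData_iff_split (ht : 1 ≤ t) (htr : t < r) :
    IsGluingData E q ↔
      IsGluingData (fun i : Fin t => E ⟨i, by omega⟩)
        (fun l : Fin (t - 1) => q ⟨l, by omega⟩) ∧
      IsGluingData (fun i : Fin (r - t) => E ⟨t + i, by omega⟩)
        (fun l : Fin (r - t - 1) => q ⟨t + l, by omega⟩) ∧
      1 ≤ q ⟨t - 1, by omega⟩ ∧
      (q ⟨t - 1, by omega⟩ : ℕ∞) ≤ Comp (E ⟨t - 1, by omega⟩) (E ⟨t, htr⟩) := by
  obtain ⟨u, rfl⟩ : ∃ u, t = u + 1 := ⟨t - 1, by omega⟩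
  constructor
  · intro hEq
    refine ⟨⟨fun i => hEq.isMultSeq _, fun l => hEq.one_le _, fun l => ?_⟩,
      ⟨fun i => hEq.isMultSeq _, fun l => hEq.one_le _, fun l => ?_⟩, hEq.one_le _, ?_⟩
    · exact hEq.le_comp ⟨l, by omega⟩
    · exact hEq.le_comp ⟨u + 1 + l, by omega⟩
    · exact hEq.le_comp ⟨u, by omega⟩
  · rintro ⟨hleft, hright, hone, hcomp⟩
    have hlevel (l : Fin (r - 1)) :
        1 ≤ q l ∧ (q l : ℕ∞) ≤ Comp (E ⟨l, by omega⟩) (E ⟨l + 1, by omega⟩) := by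
      obtain ⟨l, hl⟩ := l
      rcases lt_trichotomy l u with hlt | rfl | hgt
      · exact ⟨hleft.one_le ⟨l, hlt⟩, hleft.le_comp ⟨l, hlt⟩⟩
      · exact ⟨hone, hcomp⟩
      · obtain ⟨x, rfl⟩ := Nat.exists_eq_add_of_le (Nat.succ_le_of_lt hgt)
        exact ⟨hright.one_le ⟨x, by omega⟩, hright.le_comp ⟨x, by omega⟩⟩
    refine ⟨fun ⟨i, hi⟩ => ?_, fun l => (hlevel l).1, fun l => (hlevel l).2⟩
    rcases lt_or_ge i (u + 1) with hlt | hge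
    · exact hleft.isMultSeq ⟨i, hlt⟩
    · obtain ⟨x, rfl⟩ := Nat.exists_eq_add_of_le hge
      exact hright.isMultSeq ⟨x, by omega⟩

lemma gluingGenus_eq_split (ht : 1 ≤ t) (htr : t < r) :
    gluingGenus E q =
      gluingGenus (fun i : Fin t => E ⟨i, by omega⟩)
        (fun l : Fin (t - 1) => q ⟨l, by omega⟩) +
      q ⟨t - 1, by omega⟩ +
      gluingGenus (fun i : Fin (r - t) => E ⟨t + i, by omega⟩)
        (fun l : Fin (r - t - 1) => q ⟨t + l, by omega⟩) := by
  simp only [gluingGenus]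
  rw [sum_fin_eq_add (show r = t + (r - t) by omega),
    sum_fin_eq_add (show r - 1 = t + (r - t - 1) by omega) q,
    sum_fin_eq_add (show t = t - 1 + 1 by omega) fun l => q ⟨l, _⟩, Fin.sum_univ_one]
  simp only [Fin.val_zero, add_zero]
  ring

lemma IsGluingData.le_gluingGenus (hEq : IsGluingData E q) : r - 1 ≤ gluingGenus E q := by
  have : ∑ _k : Fin (r - 1), 1 ≤ ∑ k, q k := Finset.sum_le_sum fun k _ => hEq.one_le k
  simp only [Finset.sum_const, Finset.card_univ, Fintype.card_fin, smul_eq_mul, mul_one] at this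
  exact this.trans (Nat.le_add_left _ _)

lemma le_of_mem_gen (hT : T ∈ Gen r n) : r - 1 ≤ n := by
  obtain ⟨E, q, rfl⟩ := exists_eq_treeOf_of_mem_gen hT
  obtain ⟨hEq, rfl⟩ := treeOf_mem_gen_iff.1 hT
  exact hEq.le_gluingGenus

lemma bounds_of_mem_glueSet {ht : 1 ≤ t} {htr : t < r} {p k : ℕ}
    (hT : T ∈ glueSet r n t ht htr p k) :
    t - 1 ≤ k ∧ r - t - 1 ≤ n - p - k := by
  obtain ⟨E, q, -, hleft, hright, -⟩ := hT
  exact ⟨le_of_mem_gen hleft, le_of_mem_gen hright⟩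

lemma mem_gen_iff_exists_mem_glueSet (ht : 1 ≤ t) (htr : t < r) :
    T ∈ Gen r n ↔ ∃ p k, 1 ≤ p ∧ p + k ≤ n ∧ T ∈ glueSet r n t ht htr p k := by
  constructor
  · intro hT
    obtain ⟨E, q, rfl⟩ := exists_eq_treeOf_of_mem_gen hT
    obtain ⟨hEq, hn⟩ := treeOf_mem_gen_iff.1 hT
    obtain ⟨hleft, hright, hone, hcomp⟩ := (isGluingData_iff_split ht htr).1 hEq
    rw [gluingGenus_eq_split ht htr] at hn
    exact ⟨_, _, hone, by omega, E, q, rfl, treeOf_mem_gen_iff.2 ⟨hleft, rfl⟩,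
      treeOf_mem_gen_iff.2 ⟨hright, by omega⟩, rfl, hcomp⟩
  · rintro ⟨_, k, hone, hle, E, q, rfl, hleft, hright, rfl, hcomp⟩
    obtain ⟨hleft, hk⟩ := treeOf_mem_gen_iff.1 hleft
    obtain ⟨hright, hn⟩ := treeOf_mem_gen_iff.1 hright
    refine treeOf_mem_gen_iff.2
      ⟨(isGluingData_iff_split ht htr).2 ⟨hleft, hright, hone, hcomp⟩, ?_⟩
    rw [gluingGenus_eq_split ht htr]
    omega

end

end ArfGenus

/-- Under the hypotheses no natural-number subtraction below is truncated: `n + 2 - r`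
is `n - r + 2`, and `n + t + 1 - p - r` is `n - p - r + t + 1`. -/
theorem mainTheorem2 (r n t : ℕ) (hr : 2 ≤ r) (ht : 1 ≤ t) (htr : t < r) :
    (r - 1 ≤ n →
      ArfGenus.Gen r n =
        ⋃ p ∈ Finset.Icc 1 (n + 2 - r), ⋃ k ∈ Finset.Icc (t - 1) (n + t + 1 - p - r),
          ArfGenus.glueSet r n t ht htr p k) ∧
    (n < r - 1 → ArfGenus.Gen r n = ∅) := by
  refine ⟨fun _ => ?_, fun hn => ?_⟩
  · ext T
    simp only [ArfGenus.mem_gen_iff_exists_mem_glueSet ht htr, Set.mem_iUnion, Finset.mem_Icc,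
      exists_prop]
    constructor
    · rintro ⟨p, k, hp, hpk, hT⟩
      obtain ⟨hk, hk'⟩ := ArfGenus.bounds_of_mem_glueSet hT
      exact ⟨p, ⟨hp, by omega⟩, k, ⟨hk, by omega⟩, hT⟩
    · rintro ⟨p, ⟨hp, hp'⟩, k, ⟨_, hk⟩, hT⟩
      exact ⟨p, k, hp, by omega, hT⟩
  · exact Set.eq_empty_iff_forall_notMem.2 fun T hT => hn.not_ge (ArfGenus.le_of_mem_gen hT)
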